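/- In real quantum theory let a two-rebit vector be a real symmetric $4\times4$ matrix, regarded as acting on $\mathbb R^2\otimes\mathbb R^2$; write $AB$ for the real vector space of all of these, and let $\Omega_{AB}\subset AB$ be the set of two-rebit states, i.e. of positive semidefinite $\rho\in AB$ with $\operatorname{Tr}\rho=1$. A rebit state is a real symmetric positive semidefinite $2\times2$ matrix of trace $1$, and a rebit effect is a real symmetric $2\times2$ matrix $M$ with $0\le M\le\mathds 1$. Let $AB_\otimes\subset AB$ be the linear span of the products $\alpha\otimes\beta$ of rebit states, and let $H_S\subset AB$ be the subspace of all $h\in AB$ with $\operatorname{Tr}\big((e\otimes f)h\big)=0$ for all rebit effects $e,f$. Then $AB=AB_\otimes\oplus H_S$, and $\Pi_{\rm TL}:AB\to AB$ denotes the linear projection onto $AB_\otimes$ along $H_S$. A two-rebit matrix is separable in real quantum theory if it equals a finite sum $\sum_i p_i\,\alpha_i\otimes\beta_i$ with $p_i\ge0$, $\sum_ip_i=1$ and rebit states $\alpha_i,\beta_i$; separability of a complex $4\times4$ matrix in complex quantum theory is defined in the same way with qubit states (complex positive semidefinite $2\times2$ matrices of trace $1$). A state $\rho\in\Omega_{AB}$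 has TL-entanglement if $\Pi_{\rm TL}(\rho)$ is not separable in real quantum theory; otherwise it lacks TL-entanglement. **Proposition.** Let $\rho\in\Omega_{AB}$ be a two-rebit state. Then: 1. $\rho$ lacks TL-entanglement if and only if $\Pi_{\rm TL}(\rho)\in\Omega_{AB}$, i.e. $\Pi_{\rm TL}(\rho)$ is a valid two-rebit state. 2. Let $\iota(\rho)$ be $\rho$ regarded as a complex matrix, i.e. as a two-qubit state. If $\iota(\rho)$ is separable in complex quantum theory, then $\rho$ lacks TL-entanglement. -/

import Mathlib

open scoped Kronecker ComplexOrder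

noncomputable section

namespace RealQT

/-- Normalized states of the quantum system with levels `n` over the scalars `𝕜`: positive
semidefinite (in particular Hermitian; symmetric when `𝕜 = ℝ`) matrices of unit trace.
`𝕜 = ℝ` is real quantum theory, `𝕜 = ℂ` is complex quantum theory. -/
def states (𝕜 : Type*) [RCLike 𝕜] (n : Type*) [Fintype n] : Set (Matrix n n 𝕜) :=
  {ρ | ρ.PosSemidef ∧ ρ.trace = 1}

/-- Effects: matrices `M` with `0 ≤ M ≤ 1` in the positive semidefinite order; an effect `M` acts
on a state `ρ` by the Born rule `ρ ↦ Tr (M ρ)`. -/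
def effects (𝕜 : Type*) [RCLike 𝕜] (n : Type*) [DecidableEq n] : Set (Matrix n n 𝕜) :=
  {M | M.PosSemidef ∧ (1 - M : Matrix n n 𝕜).PosSemidef}

/-- Separable states of a bipartite system: convex combinations `∑ i, p i • (α i ⊗ β i)` of
products of normalized local states, all taken within the theory over `𝕜`. -/
def separableStates (𝕜 : Type*) [RCLike 𝕜] (m n : Type*) [Fintype m] [Fintype n] :
    Set (Matrix (m × n) (m × n) 𝕜) :=
  {ρ | ∃ (k : ℕ) (p : Fin k → ℝ) (α : Fin k → Matrix m m 𝕜) (β : Fin k → Matrix n n 𝕜),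
    (∀ i, 0 ≤ p i) ∧ ∑ i, p i = 1 ∧ (∀ i, α i ∈ states 𝕜 m) ∧ (∀ i, β i ∈ states 𝕜 n) ∧
    ρ = ∑ i, p i • (α i ⊗ₖ β i)}

/-- The real vector space of the real quantum system with levels `n`: real symmetric matrices. -/
def symSpace (n : Type*) : Submodule ℝ (Matrix n n ℝ) where
  carrier := {M | M.IsSymm}
  add_mem' h₁ h₂ := h₁.add h₂
  zero_mem' := Matrix.isSymm_zero
  smul_mem' c _ h := h.smul c

/-- The tomographically local subspace of the composite: the span of the product states. -/
def tlSubspace (m n : Type*) [Fintype m] [Fintype n] : Submodule ℝ (symSpace (m × n)) :=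
  Submodule.span ℝ
    {v | ∃ α ∈ states ℝ m, ∃ β ∈ states ℝ n, (v : Matrix (m × n) (m × n) ℝ) = α ⊗ₖ β}

/-- The holistic subspace of the composite: vectors on which every product effect vanishes. -/
def holisticSubspace (m n : Type*) [Fintype m] [Fintype n] [DecidableEq m] [DecidableEq n] :
    Submodule ℝ (symSpace (m × n)) where
  carrier := {h | ∀ e ∈ effects ℝ m, ∀ f ∈ effects ℝ n,
    Matrix.trace ((e ⊗ₖ f) * (h : Matrix (m × n) (m × n) ℝ)) = 0}
  add_mem' h₁ h₂ e he f hf := by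
    simp [Matrix.mul_add, h₁ e he f hf, h₂ e he f hf]
  zero_mem' e _ f _ := by simp
  smul_mem' c _ h e he f hf := by
    simp [h e he f hf]

/-- The rebit: the two-level system of real quantum theory. -/
abbrev Rebit : Type := Fin 2

/-- The vector space of a pair of rebits: real symmetric `4 × 4` matrices. -/
abbrev TwoRebitSpace : Type := symSpace (Rebit × Rebit)

/-- Three rebit pure states spanning the symmetric `2 × 2` matrices:
`|0⟩⟨0|`, `|1⟩⟨1|` and `|+⟩⟨+|`. -/
def probe : Fin 3 → Matrix Rebit Rebit ℝ :=
  ![!![1, 0; 0, 0], !![0, 0; 0, 1], !![1 / 2, 1 / 2; 1 / 2, 1 / 2]]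

lemma posSemidef_of_idem {M : Matrix Rebit Rebit ℝ} (h : M.transpose * M = M) :
    M.PosSemidef := by
  rw [← h, ← Matrix.conjTranspose_eq_transpose_of_trivial]
  exact Matrix.posSemidef_conjTranspose_mul_self M

lemma probe_mem_states (i : Fin 3) : probe i ∈ states ℝ Rebit := by
  refine ⟨posSemidef_of_idem ?_, ?_⟩
  · fin_cases i <;> ext a b <;> fin_cases a <;> fin_cases b <;>
      norm_num [probe, Matrix.mul_apply, Fin.sum_univ_two]
  · fin_cases i <;> norm_num [probe, Matrix.trace, Fin.sum_univ_two]

lemma probe_mem_effects (i : Fin 3) : probe i ∈ effects ℝ Rebit := by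
  refine ⟨(probe_mem_states i).1, posSemidef_of_idem ?_⟩
  fin_cases i <;> ext a b <;> fin_cases a <;> fin_cases b <;>
    norm_num [probe, Matrix.mul_apply, Fin.sum_univ_two]

/-- The holistic vectors of two rebits are antisymmetric under transposition of one factor. -/
lemma holistic_apply {h : TwoRebitSpace} (hh : h ∈ holisticSubspace Rebit Rebit)
    (a b c d : Rebit) : h.1 (a, b) (c, d) = - h.1 (a, d) (c, b) := by
  have sy : ∀ x y, h.1 x y = h.1 y x := fun x y => Matrix.IsSymm.apply h.2 y x
  have key : ∀ i j : Fin 3, Matrix.trace ((probe i ⊗ₖ probe j) * h.1) = 0 := fun i j =>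
    hh _ (probe_mem_effects i) _ (probe_mem_effects j)
  have k := fun i j => key i j
  simp only [Matrix.trace, Matrix.diag, Matrix.mul_apply, Fintype.sum_prod_type,
    Fin.sum_univ_two, Matrix.kroneckerMap_apply] at k
  have k00 := k 0 0
  have k01 := k 0 1
  have k02 := k 0 2
  have k10 := k 1 0
  have k11 := k 1 1
  have k12 := k 1 2
  have k20 := k 2 0
  have k21 := k 2 1
  have k22 := k 2 2
  have s1 := sy (0, 0) (0, 1)
  have s2 := sy (0, 0) (1, 0)
  have s3 := sy (0, 0) (1, 1)
  have s4 := sy (0, 1) (1, 0)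
  have s5 := sy (0, 1) (1, 1)
  have s6 := sy (1, 0) (1, 1)
  simp [probe] at k00 k01 k02 k10 k11 k12 k20 k21 k22
  fin_cases a <;> fin_cases b <;> fin_cases c <;> fin_cases d <;> simp <;> linarith

/-- The tomographically local vectors are symmetric under transposition of one factor. -/
lemma tl_apply {v : TwoRebitSpace} (hv : v ∈ tlSubspace Rebit Rebit) :
    ∀ a b c d : Rebit, v.1 (a, b) (c, d) = v.1 (a, d) (c, b) := by
  induction hv using Submodule.span_induction with
  | mem x hx =>
    obtain ⟨α, -, β, hβ, hx⟩ := hx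
    intro a b c d
    have : β b d = β d b := by simpa using (hβ.1.isHermitian.apply b d).symm
    rw [hx]
    simp [Matrix.kroneckerMap_apply, this]
  | zero => simp
  | add x y _ _ hx hy => intro a b c d; simp [hx a b c d, hy a b c d]
  | smul r x _ hx => intro a b c d; simp [hx a b c d]

/-- Conversely, symmetry under transposition of one factor characterizes the span of the product
states. -/
lemma mem_tl {v : TwoRebitSpace}
    (hv : ∀ a b c d : Rebit, v.1 (a, b) (c, d) = v.1 (a, d) (c, b)) :
    v ∈ tlSubspace Rebit Rebit := by
  have sy : ∀ x y, v.1 x y = v.1 y x := fun x y => Matrix.IsSymm.apply v.2 y x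
  have hp : ∀ i j : Fin 3, (probe i ⊗ₖ probe j) ∈ symSpace (Rebit × Rebit) := by
    intro i j
    have h := fun i => (probe_mem_states i).1.isHermitian
    refine Matrix.IsSymm.ext ?_
    rintro ⟨a, b⟩ ⟨c, d⟩
    have h1 : probe i a c = probe i c a := by simpa using ((h i).apply a c).symm
    have h2 : probe j b d = probe j d b := by simpa using ((h j).apply b d).symm
    simp [Matrix.kroneckerMap_apply, h1, h2]
  let w : Fin 3 → Rebit → Rebit → ℝ :=
    ![!![1, -1; 0, 0], !![0, -1; 0, 1], !![0, 2; 0, 0]]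
  have e : v = ∑ i : Fin 3, ∑ j : Fin 3,
      (∑ a, ∑ b, ∑ c, ∑ d, w i a c * w j b d * v.1 (a, b) (c, d)) •
        (⟨probe i ⊗ₖ probe j, hp i j⟩ : TwoRebitSpace) := by
    have s1 := sy (0, 0) (0, 1)
    have s2 := sy (0, 0) (1, 0)
    have s3 := sy (0, 0) (1, 1)
    have s4 := sy (0, 1) (1, 0)
    have s5 := sy (0, 1) (1, 1)
    have s6 := sy (1, 0) (1, 1)
    have t := hv 0 0 1 1
    ext ⟨a, b⟩ ⟨c, d⟩
    fin_cases a <;> fin_cases b <;> fin_cases c <;> fin_cases d <;>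
      simp [Fin.sum_univ_succ, w, probe, Matrix.kroneckerMap_apply] <;> linarith
  rw [e]
  refine Submodule.sum_mem _ fun i _ => Submodule.sum_mem _ fun j _ => Submodule.smul_mem _ _ ?_
  exact Submodule.subset_span ⟨_, probe_mem_states i, _, probe_mem_states j, rfl⟩

/-- Symmetric matrices antisymmetric under transposition of one factor are holistic. -/
lemma mem_holistic {h : TwoRebitSpace}
    (hh : ∀ a b c d : Rebit, h.1 (a, b) (c, d) = - h.1 (a, d) (c, b)) :
    h ∈ holisticSubspace Rebit Rebit := by
  intro e _ f hf
  have hs : f 0 1 = f 1 0 := by simpa using (hf.1.isHermitian.apply 0 1).symm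
  have z : ∀ a b c : Rebit, h.1 (a, b) (c, b) = 0 := fun a b c => by
    have := hh a b c b
    linarith
  have t : ∀ a c : Rebit, h.1 (a, 0) (c, 1) = - h.1 (a, 1) (c, 0) := fun a c => hh a 0 c 1
  simp only [Matrix.trace, Matrix.diag, Matrix.mul_apply, Fintype.sum_prod_type,
    Fin.sum_univ_two, Matrix.kroneckerMap_apply, z, t, hs]
  ring

/-- The space of a pair of rebits is the direct sum of its tomographically local subspace and its
holistic subspace. -/
theorem isCompl_tl_holistic :
    IsCompl (tlSubspace Rebit Rebit) (holisticSubspace Rebit Rebit) := by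
  constructor
  · rw [Submodule.disjoint_def]
    intro x h₁ h₂
    ext ⟨a, b⟩ ⟨c, d⟩
    have e₁ := tl_apply h₁ a b c d
    have e₂ := holistic_apply h₂ a b c d
    simp only [ZeroMemClass.coe_zero, Matrix.zero_apply]
    linarith
  · rw [codisjoint_iff, Submodule.eq_top_iff']
    intro v
    have sy : ∀ x y, v.1 x y = v.1 y x := fun x y => Matrix.IsSymm.apply v.2 y x
    let τ : TwoRebitSpace := ⟨fun x y => v.1 (x.1, y.2) (y.1, x.2), by
      ext x y
      exact sy _ _⟩
    have hτ : ∀ a b c d, τ.1 (a, b) (c, d) = v.1 (a, d) (c, b) := fun _ _ _ _ => rfl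
    refine Submodule.mem_sup.2 ⟨(1 / 2 : ℝ) • (v + τ), mem_tl ?_, (1 / 2 : ℝ) • (v - τ),
      mem_holistic ?_, ?_⟩
    · intro a b c d
      simp [hτ, add_comm]
    · intro a b c d
      simp [hτ]
      ring
    · module

/-- The projection `Π_TL` of the two-rebit space onto its tomographically local subspace along
its holistic subspace. -/
def PiTL : TwoRebitSpace →ₗ[ℝ] TwoRebitSpace :=
  (tlSubspace Rebit Rebit).projection (holisticSubspace Rebit Rebit) isCompl_tl_holistic

/-- A two-rebit state has TL-entanglement when its tomographically local component is not
separable in real quantum theory. -/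
def HasTLEntanglement (ρ : TwoRebitSpace) : Prop :=
  (PiTL ρ : Matrix (Rebit × Rebit) (Rebit × Rebit) ℝ) ∉ separableStates ℝ Rebit Rebit

/-- The natural inclusion of two-rebit vectors into two-qubit matrices, entry by entry. -/
def toQubits (ρ : TwoRebitSpace) : Matrix (Fin 2 × Fin 2) (Fin 2 × Fin 2) ℂ :=
  (ρ : Matrix (Rebit × Rebit) (Rebit × Rebit) ℝ).map Complex.ofReal

end RealQT

end

open Matrix

/-! `PiTL` averages a vector with its partial transpose (`PiTL_apply`), so its values are invariant
under transposing one factor. An invariant symmetric matrix has blocks (A B; B C) with B symmetric.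
If it is also positive, one congruence diagonalizes both A = Wᵀ W and B = Wᵀ D W, and the Schur
complement C - Wᵀ D² W is positive. With wᵢ the rows of W, the matrix is ∑ (1, dᵢ)(1, dᵢ)ᵀ ⊗ wᵢ wᵢᵀ
plus that complement in the last block, which is separable
(`separable_of_partialTranspose_invariant`). For complex separable states, the average with the
partial transpose cancels every term Im αᵢ ⊗ Im βᵢ, because Im βᵢ is antisymmetric. What remains is
∑ pᵢ Re αᵢ ⊗ Re βᵢ. -/

namespace RealQT

/-! ### Separable states and the cone of positive products. -/

/-- Elements of the cone generated by products of positive semidefinite matrices, once their trace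
is normalized, are separable. -/
lemma separable_of_mem_closure {m n : Type*} [Fintype m] [Fintype n]
    {M : Matrix (m × n) (m × n) ℝ}
    (hM : M ∈ AddSubmonoid.closure
      {X | ∃ P : Matrix m m ℝ, P.PosSemidef ∧ ∃ Q : Matrix n n ℝ, Q.PosSemidef ∧ X = P ⊗ₖ Q})
    (htr : M.trace = 1) : M ∈ separableStates ℝ m n := by
  have key : ∃ (k : ℕ) (p : Fin k → ℝ) (α : Fin k → Matrix m m ℝ) (β : Fin k → Matrix n n ℝ),
      (∀ i, 0 ≤ p i) ∧ (∀ i, α i ∈ states ℝ m) ∧ (∀ i, β i ∈ states ℝ n) ∧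
      M = ∑ i, p i • (α i ⊗ₖ β i) := by
    clear htr
    induction hM using AddSubmonoid.closure_induction with
    | mem x hx =>
      obtain ⟨P, hP, Q, hQ, rfl⟩ := hx
      -- A traceless positive factor is zero, and the empty sum serves; otherwise both factors are
      -- normalized and the traces become the weight.
      by_cases hP0 : P.trace = 0
      · refine ⟨0, ![], ![], ![], by simp, by simp, by simp, ?_⟩
        simp [hP.trace_eq_zero_iff.1 hP0]
      by_cases hQ0 : Q.trace = 0
      · refine ⟨0, ![], ![], ![], by simp, by simp, by simp, ?_⟩
        simp [hQ.trace_eq_zero_iff.1 hQ0]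
      refine ⟨1, fun _ => P.trace * Q.trace, fun _ => P.trace⁻¹ • P, fun _ => Q.trace⁻¹ • Q,
        fun _ => mul_nonneg hP.trace_nonneg hQ.trace_nonneg,
        fun _ => ⟨hP.smul (inv_nonneg.2 hP.trace_nonneg), by simp [hP0]⟩,
        fun _ => ⟨hQ.smul (inv_nonneg.2 hQ.trace_nonneg), by simp [hQ0]⟩, ?_⟩
      simp only [Finset.univ_unique, Finset.sum_const, Finset.card_singleton, one_smul]
      rw [smul_kronecker, kronecker_smul, smul_smul, smul_smul]
      field_simp
      simp
    | zero => exact ⟨0, ![], ![], ![], by simp, by simp, by simp, by simp⟩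
    | add x y _ _ hx hy =>
      obtain ⟨k, p, α, β, hp, hα, hβ, rfl⟩ := hx
      obtain ⟨l, q, γ, δ, hq, hγ, hδ, rfl⟩ := hy
      refine ⟨k + l, Fin.append p q, Fin.append α γ, Fin.append β δ, ?_, ?_, ?_, ?_⟩
      · intro i
        refine Fin.addCases (fun i => ?_) (fun i => ?_) i <;> simp [hp, hq]
      · intro i
        refine Fin.addCases (fun i => ?_) (fun i => ?_) i <;> simp [hα, hγ]
      · intro i
        refine Fin.addCases (fun i => ?_) (fun i => ?_) i <;> simp [hβ, hδ]
      · simp [Fin.sum_univ_add]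
  obtain ⟨k, p, α, β, hp, hα, hβ, rfl⟩ := key
  refine ⟨k, p, α, β, hp, ?_, hα, hβ, rfl⟩
  simpa [trace_sum, trace_smul, trace_kronecker, (hα _).2, (hβ _).2] using htr

/-- Separable states are states. -/
lemma separableStates_subset_states (m n : Type*) [Fintype m] [Fintype n] :
    separableStates ℝ m n ⊆ states ℝ (m × n) := by
  rintro _ ⟨k, p, α, β, hp, hs, hα, hβ, rfl⟩
  refine ⟨posSemidef_sum _ fun i _ => ((hα i).1.kronecker (hβ i).1).smul (hp i), ?_⟩
  simpa [trace_sum, trace_smul, trace_kronecker, (hα _).2, (hβ _).2] using hs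

/-! ### Simultaneous diagonalization by congruence. -/

open scoped MatrixOrder in
/-- A real positive semidefinite matrix is a Gram matrix. -/
lemma exists_eq_transpose_mul_self {n : Type*} [Fintype n] {A : Matrix n n ℝ}
    (hA : A.PosSemidef) : ∃ R : Matrix n n ℝ, A = Rᵀ * R := by
  classical
  obtain ⟨R, hR⟩ := CStarAlgebra.nonneg_iff_eq_star_mul_self.1 hA.nonneg
  rw [star_eq_conjTranspose, conjTranspose_eq_transpose_of_trivial] at hR
  exact ⟨R, hR⟩

/-- A positive definite and a symmetric matrix are simultaneously diagonalized by a congruence. -/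
lemma exists_congruence_diagonal {n : Type*} [Fintype n] [DecidableEq n] {A B : Matrix n n ℝ}
    (hA : A.PosDef) (hB : B.IsSymm) :
    ∃ (W : Matrix n n ℝ) (d : n → ℝ), IsUnit W.det ∧ A = Wᵀ * W ∧ B = Wᵀ * diagonal d * W := by
  obtain ⟨R, hR⟩ := exists_eq_transpose_mul_self hA.posSemidef
  have hRu : IsUnit R.det := by
    have h := hA.det_pos.ne'
    rw [hR, det_mul] at h
    exact (right_ne_zero_of_mul h).isUnit
  -- The congruence by R⁻¹ turns A into 1, so an orthogonal diagonalization of the transformed B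
  -- does not disturb it.
  have hX : (R⁻¹ᵀ * B * R⁻¹).IsHermitian := by
    rw [IsHermitian, conjTranspose_eq_transpose_of_trivial]
    simp [transpose_mul, hB.eq, Matrix.mul_assoc]
  have hs := hX.spectral_theorem
  rw [Unitary.conjStarAlgAut_apply] at hs
  set U : Matrix n n ℝ := (hX.eigenvectorUnitary : Matrix n n ℝ)
  set d := hX.eigenvalues
  have hU : U * Uᵀ = 1 := by
    have := Unitary.coe_mul_star_self hX.eigenvectorUnitary
    rwa [Unitary.coe_star, star_eq_conjTranspose, conjTranspose_eq_transpose_of_trivial] at this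
  have hs' : R⁻¹ᵀ * B * R⁻¹ = U * diagonal d * Uᵀ := by
    simpa [star_eq_conjTranspose, conjTranspose_eq_transpose_of_trivial, Function.comp_def]
      using hs
  refine ⟨Uᵀ * R, d, ?_, ?_, ?_⟩
  · rw [det_mul]
    refine IsUnit.mul ?_ hRu
    exact (isUnit_iff_isUnit_det _).1 (IsUnit.of_mul_eq_one_right _ hU)
  · rw [hR, transpose_mul, transpose_transpose, Matrix.mul_assoc, ← Matrix.mul_assoc U, hU,
      Matrix.one_mul]
  · have h1 : Rᵀ * R⁻¹ᵀ = 1 := by rw [← transpose_mul, nonsing_inv_mul _ hRu, transpose_one]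
    calc B = (Rᵀ * R⁻¹ᵀ) * B * (R⁻¹ * R) := by
            rw [h1, nonsing_inv_mul _ hRu, Matrix.one_mul, Matrix.mul_one]
      _ = Rᵀ * (R⁻¹ᵀ * B * R⁻¹) * R := by simp only [Matrix.mul_assoc]
      _ = _ := by
            rw [hs', transpose_mul, transpose_transpose]
            simp only [Matrix.mul_assoc]

/-- A symmetric `2 × 2` matrix which vanishes on the kernel of a singular symmetric one is a
multiple of it. -/
lemma exists_eq_smul_of_ker_le {A B : Matrix (Fin 2) (Fin 2) ℝ} (hA : A.IsSymm) (hB : B.IsSymm)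
    (hdet : A.det = 0) (hker : ∀ v, A *ᵥ v = 0 → B *ᵥ v = 0) : ∃ t : ℝ, B = t • A := by
  have hA' := hA.apply 0 1
  have hB' := hB.apply 0 1
  rw [det_fin_two, hA'] at hdet
  -- Up to sign, the test vectors are the columns of the adjugate of A, killed by A since det A = 0.
  have k₁ := hker ![A 0 1, -A 0 0] (by
    ext i; fin_cases i <;> simp [mulVec, dotProduct, Fin.sum_univ_two, hA'] <;> linarith)
  have k₂ := hker ![A 1 1, -A 0 1] (by
    ext i; fin_cases i <;> simp [mulVec, dotProduct, Fin.sum_univ_two, hA'] <;> linarith)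
  have k₁₀ := congrFun k₁ 0
  have k₁₁ := congrFun k₁ 1
  have k₂₀ := congrFun k₂ 0
  have k₂₁ := congrFun k₂ 1
  simp [mulVec, dotProduct, Fin.sum_univ_two, hB'] at k₁₀ k₁₁ k₂₀ k₂₁
  by_cases h0 : A 0 0 = 0
  · have h01 : A 0 1 = 0 := by
      rw [h0] at hdet
      nlinarith
    by_cases h1 : A 1 1 = 0
    · have hA0 : A = 0 := by
        ext i j; fin_cases i <;> fin_cases j <;> simp [h0, h01, h1, hA']
      refine ⟨0, ?_⟩
      rw [zero_smul]
      refine ext_of_mulVec_single fun i => ?_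
      rw [hker _ (by rw [hA0, zero_mulVec]), zero_mulVec]
    · refine ⟨B 1 1 / A 1 1, ?_⟩
      simp [h01, h1] at k₂₀ k₂₁
      ext i j; fin_cases i <;> fin_cases j <;> simp [h0, h01, h1, hA', hB', k₂₀] <;> linarith
  · refine ⟨B 0 0 / A 0 0, ?_⟩
    ext i j
    fin_cases i <;> fin_cases j <;> simp [hA', hB'] <;> field_simp <;> linarith

/-- The blocks `A`, `B` of the first column of a positive semidefinite `4 × 4` matrix, with `B`
symmetric, are simultaneously diagonalized by a congruence, even if `A` is singular. -/
lemma exists_block_congruence {M : Matrix (Fin 2 × Fin 2) (Fin 2 × Fin 2) ℝ} (hM : M.PosSemidef)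
    {A B : Matrix (Fin 2) (Fin 2) ℝ} (hA : ∀ i j, M (0, i) (0, j) = A i j)
    (hB : ∀ i j, M (1, i) (0, j) = B i j) (hBs : B.IsSymm) :
    ∃ (W E : Matrix (Fin 2) (Fin 2) ℝ) (d : Fin 2 → ℝ),
      A = Wᵀ * W ∧ B = Wᵀ * diagonal d * W ∧ W * E = diagonal d * W := by
  have hAp : A.PosSemidef := by
    have h := hM.submatrix (fun i : Fin 2 => ((0 : Fin 2), i))
    convert h using 1
    ext i j
    exact (hA i j).symm
  by_cases hdet : A.det = 0
  · have hAs : A.IsSymm := by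
      simpa [IsSymm, conjTranspose_eq_transpose_of_trivial] using hAp.isHermitian.eq
    -- If A v = 0, the quadratic form of M vanishes at (v, 0); by positivity M kills (v, 0), and the
    -- lower block of this says B v = 0.
    obtain ⟨t, rfl⟩ := exists_eq_smul_of_ker_le hAs hBs hdet fun v hv => by
      have h0 : ∀ i, ∑ j, A i j * v j = 0 := fun i => congrFun hv i
      have h := (hM.dotProduct_mulVec_zero_iff (fun x => if x.1 = 0 then v x.2 else 0)).1 (by
        simp [dotProduct, mulVec, Fintype.sum_prod_type, hA]
        simp only [Fin.sum_univ_two] at h0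
        rw [h0, h0]
        simp)
      ext i
      have := congrFun h (1, i)
      simpa [dotProduct, mulVec, Fintype.sum_prod_type, hB] using this
    obtain ⟨W, hW⟩ := exists_eq_transpose_mul_self hAp
    have hd : diagonal (fun _ : Fin 2 => t) = t • (1 : Matrix (Fin 2) (Fin 2) ℝ) := by
      rw [smul_one_eq_diagonal]
    refine ⟨W, t • 1, fun _ => t, hW, ?_, ?_⟩ <;> simp [hd, hW]
  · obtain ⟨W, d, hW, h₁, h₂⟩ :=
      exists_congruence_diagonal (hAp.posDef_iff_det_ne_zero.2 hdet) hBs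
    refine ⟨W, W⁻¹ * diagonal d * W, d, h₁, h₂, ?_⟩
    rw [← Matrix.mul_assoc, ← Matrix.mul_assoc, mul_nonsing_inv _ hW, Matrix.one_mul]

/-! ### Invariant states are separable. -/

/-- A two-rebit state which is invariant under transposition of one factor is separable. -/
lemma separable_of_partialTranspose_invariant {M : Matrix (Fin 2 × Fin 2) (Fin 2 × Fin 2) ℝ}
    (hM : M ∈ states ℝ (Fin 2 × Fin 2))
    (hPT : ∀ a b c d, M (a, b) (c, d) = M (a, d) (c, b)) :
    M ∈ separableStates ℝ (Fin 2) (Fin 2) := by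
  obtain ⟨hM, htr⟩ := hM
  refine separable_of_mem_closure ?_ htr
  have sy : ∀ x y, M x y = M y x := fun x y => by simpa using (hM.isHermitian.apply x y).symm
  let A : Matrix (Fin 2) (Fin 2) ℝ := of fun i j => M (0, i) (0, j)
  let B : Matrix (Fin 2) (Fin 2) ℝ := of fun i j => M (1, i) (0, j)
  let C : Matrix (Fin 2) (Fin 2) ℝ := of fun i j => M (1, i) (1, j)
  have hBs : B.IsSymm := IsSymm.ext fun i j => hPT 1 j 0 i
  obtain ⟨W, E, d, hA, hB, hE⟩ := exists_block_congruence hM (A := A) (B := B)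
    (fun _ _ => rfl) (fun _ _ => rfl) hBs
  have hE' : Eᵀ * Wᵀ = Wᵀ * diagonal d := by
    rw [← transpose_mul, hE, transpose_mul, diagonal_transpose]
  -- Schur complement, by compressing M with K = (-E; 1). Since A E = B, the matrix E replaces A⁻¹ B
  -- even when A is singular.
  have hS : (C - Wᵀ * diagonal d * diagonal d * W).PosSemidef := by
    let K : Matrix (Fin 2 × Fin 2) (Fin 2) ℝ :=
      of fun x j => if x.1 = 0 then -E x.2 j else (1 : Matrix (Fin 2) (Fin 2) ℝ) x.2 j
    have h := hM.conjTranspose_mul_mul_same K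
    have e : Kᴴ * M * K = Eᵀ * A * E - Eᵀ * B - B * E + C := by
      have h01 : ∀ i j, M (0, i) (1, j) = M (1, i) (0, j) := fun i j => by rw [sy, hPT]
      ext i j
      fin_cases i <;> fin_cases j <;>
        simp [K, A, B, C, mul_apply, Fintype.sum_prod_type, Fin.sum_univ_two, h01] <;> ring
    have e₁ : Eᵀ * A * E = Wᵀ * diagonal d * diagonal d * W := by
      rw [hA, ← Matrix.mul_assoc, hE', Matrix.mul_assoc, hE, ← Matrix.mul_assoc]
    have e₂ : Eᵀ * B = Wᵀ * diagonal d * diagonal d * W := by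
      rw [hB, ← Matrix.mul_assoc, ← Matrix.mul_assoc, hE']
    have e₃ : B * E = Wᵀ * diagonal d * diagonal d * W := by
      rw [hB, Matrix.mul_assoc, hE, ← Matrix.mul_assoc]
    rw [e, e₁, e₂, e₃] at h
    rwa [sub_self, zero_sub, neg_add_eq_sub] at h
  have hvec : ∀ v : Fin 2 → ℝ, (vecMulVec v v).PosSemidef := fun v => by
    simpa using posSemidef_vecMulVec_self_star v
  have hdec : M = (∑ i, vecMulVec ![1, d i] ![1, d i] ⊗ₖ vecMulVec (W i) (W i)) +
      vecMulVec ![0, 1] ![0, 1] ⊗ₖ (C - Wᵀ * diagonal d * diagonal d * W) := by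
    have hA' : ∀ i j, M (0, i) (0, j) = (Wᵀ * W) i j := fun i j => by rw [← hA]; rfl
    have hB' : ∀ i j, M (1, i) (0, j) = (Wᵀ * diagonal d * W) i j := fun i j => by
      rw [← hB]; rfl
    have hB'' : ∀ i j, M (0, i) (1, j) = (Wᵀ * diagonal d * W) i j := fun i j => by
      rw [sy, hPT, hB']
    ext ⟨a, b⟩ ⟨c, e⟩
    fin_cases a <;> fin_cases c <;>
      simp [hA', hB', hB'', C, vecMulVec, mul_apply, Fin.sum_univ_two, diagonal] <;>
      fin_cases b <;> fin_cases e <;> simp <;> ring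
  rw [hdec]
  exact add_mem (sum_mem fun i _ => AddSubmonoid.subset_closure
    ⟨_, hvec _, _, hvec _, rfl⟩) (AddSubmonoid.subset_closure ⟨_, hvec _, _, hS, rfl⟩)

/-! ### The projection, and real parts of complex states. -/

/-- The projection `PiTL` averages a vector with its partial transpose. -/
lemma PiTL_apply (ρ : TwoRebitSpace) (a b c d : Rebit) :
    (PiTL ρ).1 (a, b) (c, d) = (ρ.1 (a, b) (c, d) + ρ.1 (a, d) (c, b)) / 2 := by
  have h₁ : PiTL ρ ∈ tlSubspace Rebit Rebit :=
    Submodule.projection_apply_mem isCompl_tl_holistic ρ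
  have h₂ : ρ - PiTL ρ ∈ holisticSubspace Rebit Rebit := by
    rw [← Submodule.projection_apply_eq_zero_iff isCompl_tl_holistic, map_sub]
    exact sub_eq_zero.2 (Submodule.projection_apply_of_mem_left isCompl_tl_holistic h₁).symm
  have e₁ := tl_apply h₁ a b c d
  have e₂ := holistic_apply h₂ a b c d
  simp only [Submodule.coe_sub, Matrix.sub_apply] at e₂
  linarith

/-- The entrywise real part of a complex state is a real state. -/
lemma map_re_mem_states {n : Type*} [Fintype n] {α : Matrix n n ℂ} (hα : α ∈ states ℂ n) :
    α.map Complex.re ∈ states ℝ n := by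
  refine ⟨.of_dotProduct_mulVec_nonneg ?_ fun x => ?_, ?_⟩
  · ext i j
    simpa using congrArg Complex.re (hα.1.isHermitian.apply i j)
  · have h := (Complex.le_def.1 (hα.1.dotProduct_mulVec_nonneg (fun i => (x i : ℂ)))).1
    simpa [dotProduct, mulVec] using h
  · simpa [trace] using congrArg Complex.re hα.2

end RealQT

theorem proposition7 (ρ : RealQT.TwoRebitSpace)
    (hρ : (ρ : Matrix (RealQT.Rebit × RealQT.Rebit) (RealQT.Rebit × RealQT.Rebit) ℝ) ∈
      RealQT.states ℝ (RealQT.Rebit × RealQT.Rebit)) :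
    (¬ RealQT.HasTLEntanglement ρ ↔
      (RealQT.PiTL ρ : Matrix (RealQT.Rebit × RealQT.Rebit) (RealQT.Rebit × RealQT.Rebit) ℝ) ∈
        RealQT.states ℝ (RealQT.Rebit × RealQT.Rebit)) ∧
    (RealQT.toQubits ρ ∈ RealQT.separableStates ℂ (Fin 2) (Fin 2) →
      ¬ RealQT.HasTLEntanglement ρ) := by
  refine ⟨?_, ?_⟩
  · rw [RealQT.HasTLEntanglement, not_not]
    refine ⟨fun h => RealQT.separableStates_subset_states _ _ h, fun h =>
      RealQT.separable_of_partialTranspose_invariant h fun a b c d => ?_⟩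
    rw [RealQT.PiTL_apply, RealQT.PiTL_apply, add_comm]
  · rintro ⟨k, p, α, β, hp, hs, hα, hβ, h⟩
    rw [RealQT.HasTLEntanglement, not_not]
    refine ⟨k, p, fun i => (α i).map Complex.re, fun i => (β i).map Complex.re, hp, hs,
      fun i => RealQT.map_re_mem_states (hα i), fun i => RealQT.map_re_mem_states (hβ i), ?_⟩
    have hre : ∀ a b c d, ρ.1 (a, b) (c, d) =
        ∑ i, p i * ((α i a c).re * (β i b d).re - (α i a c).im * (β i b d).im) := by
      intro a b c d
      have := congrArg Complex.re (congrFun (congrFun h (a, b)) (c, d))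
      simpa [RealQT.toQubits, Matrix.sum_apply] using this
    -- Transposing the second factor conjugates βᵢ, flipping the sign of the Im·Im term in `hre`.
    have hβs : ∀ i b d, β i b d = star (β i d b) := fun i b d =>
      ((hβ i).1.isHermitian.apply b d).symm
    ext ⟨a, b⟩ ⟨c, d⟩
    rw [RealQT.PiTL_apply, hre, hre, ← Finset.sum_add_distrib, Finset.sum_div]
    simp only [Matrix.sum_apply, Matrix.smul_apply, kroneckerMap_apply, map_apply, smul_eq_mul]
    refine Finset.sum_congr rfl fun i _ => ?_
    rw [hβs i d b]
    simp
    ring
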